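/- Let $G$ be an infinite discrete group that is amenable, i.e. admits a finitely additive left-invariant probability measure defined on all subsets of $G$. Let $\mathcal{L}$ be a first-order language and let $G$ be equipped with an $\mathcal{L}$-structure expanding the group, i.e. the group operation of $G$ is the interpretation of some binary function symbol $\cdot$ of $\mathcal{L}$. Let $A\subseteq G$ be a stable definable set: $A=\varphi(G)$ for some $\mathcal{L}$-formula $\varphi(x)$ with parameters from $G$ such that the two-variable formula $\varphi(x\cdot y)$ does not have the order property, i.e. in no model of the complete theory of $G$ with all elements of $G$ named by constants are there sequences $(a_i)_{i<\omega}$, $(b_j)_{j<\omega}$ such that, for all $i,j$, $\varphi(a_i\cdot b_j)$ holds if and only if $i\le j$. A (left) Følner net in $G$ is a net $(F_i)_i$ of subsets of $G$, eventually finite and nonempty, such that $|gF_i\mathbin{\triangle}F_i|/|F_i|\to 0$ for every $g\in G$, and the upper Banach density $\mathrm{BD}(A)$ is the supremum of $\limsup_i |A\cap F_i|/|F_i|$ over all Følner nets $(F_i)_i$ in $G$ (if $G$ is countable, it is the same to take the supremum over Følner sequences only). If $\mathrm{BD}(A)>0$, then there are infinite sets $B,C\subseteq G$ such that $B\cdot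 C=\{bc : b\in B,\ c\in C\}\subseteq A$. -/

import Mathlib

open FirstOrder Filter MeasureTheory
open scoped Pointwise ENNReal Topology

universe u v w

section Amenability

/-- A discrete group is amenable if it carries a finitely additive, left-invariant probability
measure defined on all of its subsets. -/
def IsAmenableGroup (G : Type w) [Group G] : Prop :=
  ∃ m : Set G → ℝ≥0∞, m Set.univ = 1 ∧
    (∀ S T : Set G, Disjoint S T → m (S ∪ T) = m S + m T) ∧
    ∀ (g : G) (S : Set G), m (g • S) = m S

/-- `F` is a (left) Følner family in the discrete group `G`, along the filter `l`: eventually `F i`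
is finite and nonempty, and `|g F_i ∆ F_i| / |F_i| → 0` along `l` for every `g : G`.
For `l = atTop` on `ℕ` this is a Følner sequence, for `atTop` on a directed set a Følner net. -/
def IsDiscreteFolner {ι : Type*} (G : Type w) [Group G] (l : Filter ι) (F : ι → Set G) : Prop :=
  letI : MeasurableSpace G := ⊤
  IsFoelner G (Measure.count : Measure G) l F

/-- The upper density `limsup |A ∩ F_i| / |F_i|` of `A` with respect to the family `F`. -/
noncomputable def upperDensityAlong {ι : Type*} {G : Type w} (l : Filter ι) (F : ι → Set G)
    (A : Set G) : ℝ≥0∞ :=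
  letI : MeasurableSpace G := ⊤
  limsup (fun i => (Measure.count (A ∩ F i) / Measure.count (F i) : ℝ≥0∞)) l

/-- The upper Banach density of `A ⊆ G`: the supremum of the upper densities of `A` with respect to
all Følner families in `G`. All Følner nets are allowed because an uncountable group has no Følner
sequence; for a countable group sequences suffice, see `upperBanachDensity_eq_iSup_seq`. -/
noncomputable def upperBanachDensity {G : Type w} [Group G] (A : Set G) : ℝ≥0∞ :=
  ⨆ (ι : Type w) (l : Filter ι) (F : ι → Set G) (_ : IsDiscreteFolner G l F),
    upperDensityAlong l F A

/-- Families indexed by a type in another universe give nothing new. -/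
theorem upperDensityAlong_le_upperBanachDensity {ι : Type*} {G : Type w} [Group G] {l : Filter ι}
    {F : ι → Set G} (hF : IsDiscreteFolner G l F) (A : Set G) :
    upperDensityAlong l F A ≤ upperBanachDensity A := by
  let _ : MeasurableSpace G := ⊤
  have h : IsDiscreteFolner G (map F l) (id : Set G → Set G) :=
    (isFoelner_iff_tendsto _ _).2 ((isFoelner_iff_tendsto l F).1 hF)
  exact le_iSup_of_le (Set G) (le_iSup_of_le (map F l)
    (le_iSup_of_le id (le_iSup_of_le h le_rfl)))

/-- In a countable group the upper Banach density is the supremum of the upper densities with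
respect to Følner sequences. -/
theorem upperBanachDensity_eq_iSup_seq {G : Type w} [Group G] [Countable G] (A : Set G) :
    upperBanachDensity A =
      ⨆ (F : ℕ → Set G) (_ : IsDiscreteFolner G atTop F), upperDensityAlong atTop F A := by
  let _ : MeasurableSpace G := ⊤
  refine le_antisymm ?_ (iSup₂_le fun F hF => upperDensityAlong_le_upperBanachDensity hF A)
  refine iSup_le fun ι => iSup_le fun l => iSup_le fun F => iSup_le fun hF => ?_
  refine le_of_forall_lt fun c hc => ?_
  obtain ⟨d, hcd, hd⟩ := exists_between hc
  have hfr : ∃ᶠ i in l, d < (Measure.count (A ∩ F i) / Measure.count (F i) : ℝ≥0∞) :=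
    frequently_lt_of_lt_limsup (by isBoundedDefault) hd
  have hfr' : ∃ᶠ S in maxFoelner G (Measure.count : Measure G),
      d < (Measure.count (A ∩ S) / Measure.count S : ℝ≥0∞) :=
    ((isFoelner_iff_tendsto l F).1 hF).frequently hfr
  have : IsCountablyGenerated (maxFoelner G (Measure.count : Measure G)) := by
    unfold maxFoelner; infer_instance
  obtain ⟨E, hE, hEd⟩ := exists_seq_forall_of_frequently hfr'
  refine lt_of_lt_of_le hcd (le_iSup₂_of_le E ((isFoelner_iff_tendsto _ _).2 hE) ?_)
  exact le_limsup_of_frequently_le (Frequently.of_forall fun n => (hEd n).le)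
    (by isBoundedDefault)

end Amenability

section Stability

/-- The formula `ψ(x, y)` has the order property in the theory `T`: in some model of `T` there are
infinite sequences `(a_i)`, `(b_j)` such that `ψ(a_i, b_j)` holds if and only if `i ≤ j`. -/
def HasOrderProperty {L : FirstOrder.Language.{u, v}} (T : L.Theory) (ψ : L.Formula (Fin 2)) : Prop :=
  ∃ (N : T.ModelType.{u, v, max u v}) (a b : ℕ → N), ∀ i j, ψ.Realize ![a i, b j] ↔ i ≤ j

variable {L : FirstOrder.Language.{u, v}} {G : Type w}

/-- The two-variable formula `φ(x · y)`, for `φ` a one-variable formula with parameters from `G` and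
`μ` a binary function symbol of `L`, to be interpreted as the group operation. -/
def productFormula (μ : L.Functions 2) (φ : L[[G]].Formula (Fin 1)) : L[[G]].Formula (Fin 2) :=
  Language.BoundedFormula.subst φ fun _ =>
    Language.Functions.apply₂ ((L.lhomWithConstants G).onFunction μ) (Language.Term.var 0) (Language.Term.var 1)

/-- `A` is a stable definable set of the structure `G`: it is defined by a formula `φ(x)` with
parameters from `G` such that the formula `φ(x · y)`, that is `x · y ∈ A`, does not have the order
property (in the complete theory of `G` with its elements named). -/
def IsStableDefinable [L.Structure G] (μ : L.Functions 2) (A : Set G) : Prop :=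
  ∃ φ : L[[G]].Formula (Fin 1), (∀ g : G, φ.Realize ![g] ↔ g ∈ A) ∧
    ¬ HasOrderProperty (L.elementaryDiagram G) (productFormula μ φ)

end Stability

/-! Positive Banach density yields an invariant finitely additive probability `m` with `m A > 0`, so
all translates `g⁻¹ • A` have the same positive measure. Infinitely many sets of measure at least
`ε` cannot be almost disjoint in pairs (`exists_pos_lt_inter`). This lets one choose distinct `b i`
with all finite intersections of the `(b i)⁻¹ • A` infinite, hence distinct `c j` with `b i * c j ∈
A` for `i < j` (`exists_injective_seq_mem`). By Ramsey, this half of a product either extends to a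
full product of infinite sets or contains an exact half graph, and stability excludes the latter. -/

open Set

/-! ### Finitely additive probabilities and almost disjoint families -/

section FiniteAdditivity

variable {X : Type*}

/-- A finitely additive probability measure defined on all subsets of `X`. -/
structure IsFinitelyAdditiveProbability (m : Set X → ℝ≥0∞) : Prop where
  univ : m univ = 1
  union : ∀ S T : Set X, Disjoint S T → m (S ∪ T) = m S + m T

namespace IsFinitelyAdditiveProbability

variable {m : Set X → ℝ≥0∞}

theorem mono (hm : IsFinitelyAdditiveProbability m) {S T : Set X} (h : S ⊆ T) : m S ≤ m T := by
  rw [← union_sdiff_cancel h, hm.union _ _ disjoint_sdiff_right]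
  exact le_self_add

theorem le_one (hm : IsFinitelyAdditiveProbability m) (S : Set X) : m S ≤ 1 :=
  hm.univ ▸ hm.mono (subset_univ S)

theorem empty (hm : IsFinitelyAdditiveProbability m) : m ∅ = 0 := by
  have h := hm.union Set.univ ∅ (disjoint_empty _)
  rw [union_empty, hm.univ] at h
  exact (ENNReal.add_right_inj ENNReal.one_ne_top).1 (by rw [← h, add_zero])

theorem union_add_inter (hm : IsFinitelyAdditiveProbability m) (S T : Set X) :
    m (S ∪ T) + m (S ∩ T) = m S + m T := by
  have h₁ : m (S ∪ T) = m S + m (T \ S) := by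
    rw [← union_sdiff_self, hm.union _ _ disjoint_sdiff_right]
  have h₂ : m T = m (T \ S) + m (S ∩ T) := by
    rw [← hm.union _ _ (disjoint_sdiff_left.mono_right inter_subset_left), inter_comm,
      sdiff_union_inter]
  rw [h₁, h₂, add_assoc]

theorem union_le (hm : IsFinitelyAdditiveProbability m) (S T : Set X) :
    m (S ∪ T) ≤ m S + m T :=
  hm.union_add_inter S T ▸ le_self_add

theorem biUnion_lt_le (hm : IsFinitelyAdditiveProbability m) {T : ℕ → Set X} {δ : ℝ≥0∞} (n : ℕ)
    (h : ∀ i < n, m (T i) ≤ δ) : m (⋃ i < n, T i) ≤ n * δ := by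
  induction n with
  | zero => simp [hm.empty]
  | succ n ih =>
    rw [biUnion_lt_succ]
    calc m ((⋃ i < n, T i) ∪ T n) ≤ m (⋃ i < n, T i) + m (T n) := hm.union_le _ _
      _ ≤ n * δ + δ := add_le_add (ih fun i hi => h i (by omega)) (h n (by omega))
      _ = (n + 1 : ℕ) * δ := by push_cast; ring

/-- A Bonferroni inequality. -/
theorem mul_le_biUnion_lt_add (hm : IsFinitelyAdditiveProbability m) {T : ℕ → Set X}
    {ε δ : ℝ≥0∞} (hε : ∀ i, ε ≤ m (T i)) (hδ : ∀ i j, i < j → m (T i ∩ T j) ≤ δ) (n : ℕ) :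
    n * ε ≤ m (⋃ i < n, T i) + n * n * δ := by
  induction n with
  | zero => simp
  | succ n ih =>
    have hinter : m ((⋃ i < n, T i) ∩ T n) ≤ n * δ := by
      simp only [iUnion_inter]
      exact hm.biUnion_lt_le n fun i hi => hδ i n hi
    rw [biUnion_lt_succ]
    calc ((n + 1 : ℕ) : ℝ≥0∞) * ε = n * ε + ε := by push_cast; ring
      _ ≤ (m (⋃ i < n, T i) + n * n * δ) + m (T n) := add_le_add ih (hε n)
      _ = (m (⋃ i < n, T i) + m (T n)) + n * n * δ := by ring
      _ = (m ((⋃ i < n, T i) ∪ T n) + m ((⋃ i < n, T i) ∩ T n)) + n * n * δ := by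
        rw [hm.union_add_inter]
      _ ≤ (m ((⋃ i < n, T i) ∪ T n) + n * δ) + n * n * δ := by gcongr
      -- Padding from `n² + n` to `(n + 1)²`; the sharp count of pairs is not needed.
      _ ≤ (m ((⋃ i < n, T i) ∪ T n) + n * δ) + n * n * δ + (n * δ + δ) := le_self_add
      _ = m ((⋃ i < n, T i) ∪ T n) + (n + 1 : ℕ) * (n + 1 : ℕ) * δ := by push_cast; ring

/-- Among infinitely many sets of measure at least `ε`, two have an intersection whose measure is
bounded below in terms of `ε`. -/
theorem exists_pos_lt_inter (hm : IsFinitelyAdditiveProbability m) {ε : ℝ≥0∞} (hε : ε ≠ 0) :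
    ∃ δ : ℝ≥0∞, 0 < δ ∧ ∀ T : ℕ → Set X, (∀ i, ε ≤ m (T i)) →
      ∃ i j, i < j ∧ δ < m (T i ∩ T j) := by
  -- If the first `n` sets met pairwise in measure at most `1 / n²`, Bonferroni would give `n * ε ≤
  -- 1 + 1`.
  obtain ⟨n, hn⟩ := ENNReal.exists_nat_mul_gt hε (show (2 : ℝ≥0∞) ≠ ∞ by simp)
  have htop : (n : ℝ≥0∞) * n ≠ ∞ := ENNReal.mul_ne_top (by simp) (by simp)
  refine ⟨(n * n : ℝ≥0∞)⁻¹, ENNReal.inv_pos.2 htop, fun T hT => ?_⟩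
  by_contra! h
  refine hn.not_ge ((hm.mul_le_biUnion_lt_add hT h n).trans ?_)
  calc m (⋃ i < n, T i) + n * n * (n * n : ℝ≥0∞)⁻¹ ≤ 1 + 1 :=
        add_le_add (hm.le_one _) (ENNReal.mul_inv_le_one _)
    _ = 2 := one_add_one_eq_two

/-- A left-invariant finitely additive probability measure on an infinite group vanishes on finite
sets. -/
theorem eq_zero_of_finite {G : Type*} [Group G] [Infinite G] {m : Set G → ℝ≥0∞}
    (hm : IsFinitelyAdditiveProbability m) (hinv : ∀ (g : G) (S : Set G), m (g • S) = m S)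
    {S : Set G} (hS : S.Finite) : m S = 0 := by
  have hone : m {1} = 0 := by
    -- Distinct singletons are disjoint translates of `{1}`, so they cannot all have the same
    -- positive measure.
    by_contra h
    obtain ⟨δ, -, hδ⟩ := hm.exists_pos_lt_inter h
    obtain ⟨i, j, hij, hlt⟩ := hδ (fun n => {Infinite.natEmbedding G n}) fun n => by
      rw [← hinv (Infinite.natEmbedding G n) {1}]
      simp
    rw [(disjoint_singleton.2 ((Infinite.natEmbedding G).injective.ne hij.ne)).inter_eq,
      hm.empty] at hlt
    exact not_lt_bot hlt
  induction S, hS using Set.Finite.induction_on with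
  | empty => exact hm.empty
  | @insert a S _ _ ih =>
    have ha : m {a} = 0 := by
      rw [← hone, ← hinv a {1}]
      simp
    rw [insert_eq, ← nonpos_iff_eq_zero]
    exact (hm.union_le _ _).trans (by simp [ha, ih])

end IsFinitelyAdditiveProbability

end FiniteAdditivity

/-! ### Intersections of sets of large measure -/

section Intersectivity

variable {G : Type*} [Infinite G]

/-- The measures of the sets `S ∩ E g` are bounded away from zero for almost all `g`, with respect
to a fixed nonprincipal ultrafilter. -/
def IsHeavy (m : Set G → ℝ≥0∞) (E : G → Set G) (S : Set G) : Prop :=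
  ∃ ε : ℝ≥0∞, 0 < ε ∧ ∀ᶠ g in (hyperfilter G : Filter G), ε ≤ m (S ∩ E g)

variable {m : Set G → ℝ≥0∞} {E : G → Set G}

/-- Otherwise, for almost all `g`, the set `S ∩ E g` has measure at least `ε` but meets almost every
`E h` in measure below any given `δ > 0`. Greedy choice then produces infinitely many such sets with
pairwise intersections below `δ`, against `exists_pos_lt_inter`. -/
theorem IsHeavy.eventually_inter (hm : IsFinitelyAdditiveProbability m) {S : Set G}
    (hS : IsHeavy m E S) :
    ∀ᶠ g in (hyperfilter G : Filter G), IsHeavy m E (S ∩ E g) := by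
  obtain ⟨ε, hε, hev⟩ := hS
  by_contra hcon
  rw [← Ultrafilter.eventually_not] at hcon
  obtain ⟨δ, hδ, hT⟩ := hm.exists_pos_lt_inter hε.ne'
  have hlt : ∀ g, ¬ IsHeavy m E (S ∩ E g) →
      ∀ᶠ h in (hyperfilter G : Filter G), m (S ∩ E g ∩ E h) < δ := fun g hg => by
    by_contra h
    rw [← Ultrafilter.eventually_not] at h
    exact hg ⟨δ, hδ, h.mono fun _ => not_lt.1⟩
  obtain ⟨f, hf, hr⟩ := exists_seq_of_forall_finset_exists
    (fun g => ε ≤ m (S ∩ E g) ∧ ¬ IsHeavy m E (S ∩ E g))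
    (fun g h => m (S ∩ E g ∩ E h) < δ) fun s hs =>
      ((hev.and hcon).and
        ((Finset.eventually_all s).2 fun x hx => hlt x (hs x hx).2)).exists
  obtain ⟨i, j, hij, h⟩ := hT (fun n => S ∩ E (f n)) fun n => (hf n).1
  rw [← inter_inter_distrib_left, ← inter_assoc] at h
  exact h.not_gt (hr i j hij)

theorem IsHeavy.infinite (hm : IsFinitelyAdditiveProbability m)
    (hfin : ∀ S : Set G, S.Finite → m S = 0) {S : Set G} (hS : IsHeavy m E S) : S.Infinite := by
  obtain ⟨ε, hε, hev⟩ := hS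
  obtain ⟨g, hg⟩ := hev.exists
  intro h
  exact (hε.trans_le (hg.trans (hm.mono inter_subset_left))).ne' (hfin S h)

/-- If the sets `E g` have measure at least `ε`, there are an injective sequence `b` and an
injective sequence `c` such that `c j` lies in `E (b i)` for all `i < j`. -/
theorem exists_injective_seq_mem (hm : IsFinitelyAdditiveProbability m)
    (hfin : ∀ S : Set G, S.Finite → m S = 0) {ε : ℝ≥0∞} (hε : 0 < ε) (hE : ∀ g, ε ≤ m (E g)) :
    ∃ b c : ℕ → G, b.Injective ∧ c.Injective ∧ ∀ i j, i < j → c j ∈ E (b i) := by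
  have huniv : IsHeavy m E univ := ⟨ε, hε, .of_forall fun g => by simpa using hE g⟩
  have hstep : ∀ (p : {S : Set G // IsHeavy m E S}) (s : Finset G),
      ∃ g, g ∉ s ∧ IsHeavy m E (p.1 ∩ E g) := fun p s =>
    (Filter.Eventually.and (s.finite_toSet.compl_mem_hyperfilter)
      (p.2.eventually_inter hm)).exists
  choose next hnext hheavy using hstep
  -- Stage `n` records the elements `b i`, `i < n`, and the heavy intersection of the sets `E (b
  -- i)`.
  let state : ℕ → Finset G × {S : Set G // IsHeavy m E S} := Nat.rec (∅, ⟨univ, huniv⟩)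
    fun _ p => (Finset.cons (next p.2 p.1) p.1 (hnext p.2 p.1),
      ⟨p.2.1 ∩ E (next p.2 p.1), hheavy p.2 p.1⟩)
  let b : ℕ → G := fun n => next (state n).2 (state n).1
  have hfmono : Monotone fun n => (state n).1 :=
    monotone_nat_of_le_succ fun n => Finset.subset_cons (hnext (state n).2 (state n).1)
  have hSanti : Antitone fun n => (state n).2.1 :=
    antitone_nat_of_succ_le fun n => inter_subset_left
  have hb : ∀ i j, i < j → b i ≠ b j := fun i j hij h => by
    have hmem : b i ∈ (state j).1 :=
      hfmono (Nat.succ_le_of_lt hij)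
        ((Finset.mem_cons (h := hnext (state i).2 (state i).1)).2 (.inl rfl))
    rw [h] at hmem
    exact hnext (state j).2 (state j).1 hmem
  have hSE : ∀ i j, i < j → (state j).2.1 ⊆ E (b i) := fun i j hij =>
    (hSanti (Nat.succ_le_of_lt hij)).trans inter_subset_right
  -- Each new `c` is a fresh point of a later, still infinite, intersection; its stage is kept to
  -- select the matching subsequence of `b`.
  obtain ⟨f, hf, hr⟩ := exists_seq_of_forall_finset_exists
    (fun x : ℕ × G => x.2 ∈ (state x.1).2.1) (fun x y => x.1 < y.1 ∧ x.2 ≠ y.2) fun s _ => by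
      classical
      obtain ⟨y, hy, hys⟩ := ((state (s.sup Prod.fst + 1)).2.2.infinite hm hfin).exists_notMem_finset
        (s.image Prod.snd)
      refine ⟨(_, y), hy, fun x hx => ⟨Nat.lt_succ_of_le (Finset.le_sup (f := Prod.fst) hx), ?_⟩⟩
      rintro rfl
      exact hys (Finset.mem_image_of_mem _ hx)
  exact ⟨fun n => b (f n).1, fun n => (f n).2,
    Function.Injective.of_lt_imp_ne fun i j hij => hb _ _ (hr i j hij).1,
    Function.Injective.of_lt_imp_ne fun i j hij => (hr i j hij).2,
    fun i j hij => hSE _ _ (hr i j hij).1 (hf j)⟩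

end Intersectivity

/-! ### Ramsey dichotomy -/

section Ramsey

/-- The infinite Ramsey theorem for pairs. -/
theorem exists_strictMono_forall_or_forall_not (R : ℕ → ℕ → Prop) :
    ∃ f : ℕ → ℕ, StrictMono f ∧
      ((∀ i j, i < j → R (f i) (f j)) ∨ ∀ i j, i < j → ¬ R (f i) (f j)) := by
  -- Greedy choice: each new index need only avoid finitely many sets that are null for the
  -- ultrafilter. The ultrafilter decides whether `Q` is `R` or its negation.
  have key : ∀ Q : ℕ → ℕ → Prop, (∀ᶠ i in (hyperfilter ℕ : Filter ℕ),
      ∀ᶠ j in (hyperfilter ℕ : Filter ℕ), Q i j) →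
      ∃ f : ℕ → ℕ, StrictMono f ∧ ∀ i j, i < j → Q (f i) (f j) := fun Q hQ => by
    obtain ⟨f, -, hr⟩ := exists_seq_of_forall_finset_exists
      (fun i => ∀ᶠ j in (hyperfilter ℕ : Filter ℕ), Q i j) (fun i j => i < j ∧ Q i j)
      fun s hs => (hQ.and ((Finset.eventually_all s).2 fun x hx =>
        ((eventually_gt_atTop x).filter_mono Nat.hyperfilter_le_atTop).and (hs x hx))).exists
    exact ⟨f, fun i j hij => (hr i j hij).1, fun i j hij => (hr i j hij).2⟩
  by_cases h : ∀ᶠ i in (hyperfilter ℕ : Filter ℕ), ∀ᶠ j in (hyperfilter ℕ : Filter ℕ), R i j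
  · obtain ⟨f, hf, hR⟩ := key R h
    exact ⟨f, hf, .inl hR⟩
  · rw [← Ultrafilter.eventually_not] at h
    obtain ⟨f, hf, hR⟩ := key (fun i j => ¬ R i j)
      (h.mono fun i hi => Ultrafilter.eventually_not.2 hi)
    exact ⟨f, hf, .inr hR⟩

/-- A relation on two infinite sequences that holds above the diagonal contains the product of two
infinite index sets or an infinite half graph. -/
theorem exists_infinite_prod_or_half_graph {R : ℕ → ℕ → Prop} (hR : ∀ i j, i < j → R i j) :
    (∃ I J : Set ℕ, I.Infinite ∧ J.Infinite ∧ ∀ i ∈ I, ∀ j ∈ J, R i j) ∨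
      ∃ s t : ℕ → ℕ, ∀ i j, R (s i) (t j) ↔ i ≤ j := by
  -- Ramsey is applied below the diagonal. Splitting into even and odd indices avoids the diagonal,
  -- where nothing is known, and `2 * i < 2 * j + 1` is equivalent to `i ≤ j`.
  obtain ⟨f, hf, h | h⟩ := exists_strictMono_forall_or_forall_not fun i j => R j i
  · refine .inl ⟨range fun n => f (2 * n), range fun n => f (2 * n + 1),
      infinite_range_of_injective fun i j hij => ?_,
      infinite_range_of_injective fun i j hij => ?_, ?_⟩
    · have := hf.injective hij
      omega
    · have := hf.injective hij
      omega
    · rintro _ ⟨i, rfl⟩ _ ⟨j, rfl⟩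
      rcases lt_or_ge (2 * i) (2 * j + 1) with hij | hij
      · exact hR _ _ (hf hij)
      · exact h _ _ (by omega)
  · refine .inr ⟨fun n => f (2 * n), fun n => f (2 * n + 1), fun i j => ⟨fun hij => ?_, fun hij =>
      hR _ _ (hf (by omega))⟩⟩
    by_contra hlt
    exact h (2 * j + 1) (2 * i) (by omega) hij

end Ramsey

/-! ### Half graphs and the order property -/

section OrderProperty

variable {L : FirstOrder.Language.{u, v}} {G : Type w} [L.Structure G]

/-- An infinite half graph of `ψ` in `G` witnesses the order property in the elementary diagram. -/
theorem hasOrderProperty_elementaryDiagram [Nonempty G] {ψ : L[[G]].Formula (Fin 2)} {a b : ℕ → G}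
    (h : ∀ i j, ψ.Realize ![a i, b j] ↔ i ≤ j) : HasOrderProperty (L.elementaryDiagram G) ψ := by
  -- The order property asks for a model in a fixed universe, so the half graph is carried by
  -- isomorphism to a lift of `G`.
  let M : (L.elementaryDiagram G).ModelType := Language.Theory.ModelType.of _ G
  let e : M ≃[L[[G]]] M.equivInduced Equiv.ulift.{max u v, w}.symm :=
    Equiv.inducedStructureEquiv Equiv.ulift.{max u v, w}.symm
  refine ⟨Language.Theory.ModelType.equivInduced (M := M) Equiv.ulift.{max u v, w}.symm,
    fun i => e (a i), fun j => e (b j), fun i j => ?_⟩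
  have hM : ψ.Realize (M := M) ![a i, b j] ↔ i ≤ j := h i j
  rw [← hM, ← Language.StrongHomClass.realize_formula e]
  refine iff_of_eq (congrArg _ (funext fun k => ?_))
  fin_cases k <;> rfl

theorem realize_productFormula [Mul G] {μ : L.Functions 2}
    (hμ : ∀ x y : G, Language.Structure.funMap μ ![x, y] = x * y) {φ : L[[G]].Formula (Fin 1)}
    {x y : G} : (productFormula μ φ).Realize ![x, y] ↔ φ.Realize ![x * y] := by
  rw [productFormula, Language.Formula.Realize, Language.BoundedFormula.realize_subst,
    ← Language.Formula.Realize]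
  refine iff_of_eq (congrArg _ (funext fun k => ?_))
  rw [Language.Term.realize_functions_apply₂, Language.LHom.map_onFunction]
  simp [hμ]

end OrderProperty

/-! ### From density to an invariant measure -/

section Density

/-- A set of positive upper Banach density has positive measure for some left-invariant finitely
additive probability measure. -/
theorem exists_invariant_pos_of_upperBanachDensity_pos {G : Type*} [Group G] {A : Set G}
    (hA : 0 < upperBanachDensity A) :
    ∃ m : Set G → ℝ≥0∞, IsFinitelyAdditiveProbability m ∧
      (∀ (g : G) (S : Set G), m (g • S) = m S) ∧ 0 < m A := by
  let _ : MeasurableSpace G := ⊤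
  simp only [upperBanachDensity, lt_iSup_iff] at hA
  obtain ⟨ι, l, F, hF, hpos⟩ := hA
  obtain ⟨d, hd, hdl⟩ := exists_between hpos
  have hfr : ∃ᶠ i in l, d < (Measure.count (A ∩ F i) / Measure.count (F i) : ℝ≥0∞) :=
    frequently_lt_of_lt_limsup (by isBoundedDefault) hdl
  have : (l ⊓ 𝓟 {i | d < (Measure.count (A ∩ F i) / Measure.count (F i) : ℝ≥0∞)}).NeBot :=
    frequently_mem_iff_neBot.1 hfr
  -- Limits of densities along an ultrafilter that refines `l` and lives on the indices of density
  -- above `d` define the measure.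
  obtain ⟨U, hU⟩ := Ultrafilter.exists_le
    (l ⊓ 𝓟 {i | d < (Measure.count (A ∩ F i) / Measure.count (F i) : ℝ≥0∞)})
  have hFU : IsFoelner G (Measure.count : Measure G) U F :=
    IsFoelner.mono hF (hU.trans inf_le_left)
  have hdU : ∀ᶠ i in (U : Filter ι),
      d < (Measure.count (A ∩ F i) / Measure.count (F i) : ℝ≥0∞) :=
    le_principal_iff.1 (hU.trans inf_le_right)
  exact ⟨IsFoelner.mean Measure.count U F,
    ⟨hFU.mean_univ_eq_one, fun S T => hFU.mean_union_eq_add_of_disjoint S T trivial⟩,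
    hFU.mean_smul_eq_mean,
    hd.trans_le (ge_of_tendsto (hFU.tendsto_nhds_mean A) (hdU.mono fun _ => le_of_lt))⟩

end Density

theorem mainTheorem1 {G : Type w} [Group G] [Infinite G] (hG : IsAmenableGroup G)
    (L : FirstOrder.Language.{u, v}) [L.Structure G] (μ : L.Functions 2)
    (hμ : ∀ x y : G, FirstOrder.Language.Structure.funMap μ ![x, y] = x * y)
    (A : Set G) (hA : IsStableDefinable μ A) (hBD : 0 < upperBanachDensity A) :
    ∃ B C : Set G, B.Infinite ∧ C.Infinite ∧ B * C ⊆ A := by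
  obtain ⟨m, hm, hinv, hpos⟩ := exists_invariant_pos_of_upperBanachDensity_pos hBD
  obtain ⟨b, c, hb, hc, hbc⟩ := exists_injective_seq_mem hm
    (fun S hS => hm.eq_zero_of_finite hinv hS) hpos
    (E := fun g => g⁻¹ • A) fun g => (hinv g⁻¹ A).ge
  simp only [mem_inv_smul_set_iff, smul_eq_mul] at hbc
  rcases exists_infinite_prod_or_half_graph (R := fun i j => b i * c j ∈ A) hbc with
    ⟨I, J, hI, hJ, hIJ⟩ | ⟨s, t, hst⟩
  · refine ⟨b '' I, c '' J, hI.image hb.injOn, hJ.image hc.injOn, ?_⟩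
    rintro _ ⟨_, ⟨i, hi, rfl⟩, _, ⟨j, hj, rfl⟩, rfl⟩
    exact hIJ i hi j hj
  · obtain ⟨φ, hφ, hstable⟩ := hA
    exact (hstable (hasOrderProperty_elementaryDiagram (a := b ∘ s) (b := c ∘ t) fun i j => by
      rw [realize_productFormula hμ, hφ, ← hst i j]; rfl)).elim
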